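/- Let $B$ be a Noetherian separated scheme of finite Krull dimension (for instance, an excellent one). A $B$-scheme is a scheme $X$ with a separated morphism $f\colon X\to B$ that is essentially of finite type, i.e. $X$ is a localization of a scheme of finite type over $B$. For a point $x$ of a scheme and $x'\in\overline{\{x\}}$ let $\operatorname{codim}_x x'$ be the codimension of $\overline{\{x'\}}$ in $\overline{\{x\}}$. A generalized dimension function on $B$ is a function $\delta$ from the points of $B$ to the non-negative integers such that $\delta(b)\ge\delta(b')+\operatorname{codim}_b b'$ whenever $b'\in\overline{\{b\}}$. For a point $x$ of a $B$-scheme $f\colon X\to B$ put $\delta(x)=\delta(f(x))+\operatorname{tr.deg.}\,k(x)/k(f(x))$, and put $\delta(X)=\sup_{x\in X}\delta(x)$ (so $\delta(\emptyset)=\dim\emptyset=-\infty$). A morphism $u\colon U\to X$ of $B$-schemes is called generically of dimension at most $d$ (for an integer $d\ge 0$) if $\operatorname{tr.deg.}\,k(\eta)/k(u(\eta))\le d$ for every generic point $\eta$ of $U$. 1. Let $B^k$ be the irreducible components of $B$, and let $c^k$ be integers with $c^k\ge\dim B^k$. Then $\delta(b)=\min\{c^k-\operatorname{codim}_{B^k}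 b : b\in B^k\}$ is a generalized dimension function on $B$ (in particular, its values are non-negative). Let $\delta$ be any generalized dimension function on $B$, and let $X$ and $U$ be $B$-schemes. 2. If $x,x'\in X$ and $x'\in\overline{\{x\}}$, then $\delta(x)\ge\delta(x')+\operatorname{codim}_x x'$. 3. If $X\neq\emptyset$, then $\delta(X)$ is the maximum of the values of $\delta$ at the generic points of $X$, and it is a finite integer. Moreover, $\delta(X)\ge\dim X$. 4. If there is a $B$-morphism $u\colon U\to X$ generically of dimension at most $d$, then $\delta(U)\le\delta(X)+d$. If moreover $d=0$ and $u$ is dominant, then $\delta(U)=\delta(X)$. If $X\ne\emptyset$ and the image of $u$ is nowhere dense in $X$, then $\delta(U)<\delta(X)+d$. Furthermore, a $B$-morphism $u$ that is locally of finite type is generically of dimension at most $d$ if there is a dense open $V\subset U$ such that all fibres of $u|_V$ are of Krull dimension at most $d$. 5. Let $c\ge 0$, and let $U\subset X$ be a subscheme (more generally, let $U\to X$ be a $B$-morphism that is a topological embedding and surjective on local rings). If each irreducible component of $U$ is of codimension at least $c$ in some irreducible component of $X$ containing it, then $\delta(U)+c\le\delta(X)$. -/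

import Mathlib

open CategoryTheory AlgebraicGeometry TopologicalSpace

universe u

namespace GenDim

/-- The codimension in the closed irreducible subset `Y` of (the closure of) the irreducible subset
`Z`: the supremum of the lengths of the chains of irreducible closed subsets lying between `Z` and
`Y`. For points `x`, `x'` of a space such that `x'` is a specialization of `x`, the codimension
`codim_x x'` is `codim {x'} (closure {x})`. -/
noncomputable def codim {T : Type*} [TopologicalSpace T] (Z Y : Set T) : ℕ∞ :=
  ⨆ p : LTSeries {W : IrreducibleCloseds T // Z ⊆ (W : Set T) ∧ (W : Set T) ⊆ Y}, (p.length : ℕ∞)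

/-- A codimension is at most the Krull dimension; in particular, it is finite if the ambient space
has finite Krull dimension. -/
theorem codim_le_topologicalKrullDim {T : Type*} [TopologicalSpace T] [Nonempty T]
    (Z Y : Set T) : (codim Z Y : WithBot ℕ∞) ≤ topologicalKrullDim T := by
  obtain ⟨t⟩ := ‹Nonempty T›
  have : Nonempty (IrreducibleCloseds T) :=
    ⟨⟨closure {t}, isIrreducible_singleton.closure, isClosed_closure⟩⟩
  rw [topologicalKrullDim, Order.krullDim_eq_iSup_length, WithBot.coe_le_coe]
  refine iSup_le fun p => ?_
  exact le_iSup (fun q : LTSeries (IrreducibleCloseds T) => (q.length : ℕ∞))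
    (p.map (fun W => W.1) (fun _ _ h => h))

/-- `j : X ⟶ Z` exhibits `X` as a localization of the scheme `Z` : it identifies `X` with a subspace
of `Z`, and it induces isomorphisms on all local rings. (This is so for the spectrum of a
localization of a ring, for open subschemes, for the spectra of local rings, and more generally for
limits of filtered systems of open subschemes with affine transition morphisms.) -/
def IsLocalizationOf {X Z : Scheme.{u}} (j : X ⟶ Z) : Prop :=
  Topology.IsEmbedding j ∧ ∀ x : X, IsIso (j.stalkMap x)

/-- `f : X ⟶ B` is essentially of finite type: `X` is a localization of a scheme that is of
finite type over `B`. -/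
def IsEssFiniteType {X B : Scheme.{u}} (f : X ⟶ B) : Prop :=
  ∃ (Z : Scheme.{u}) (j : X ⟶ Z) (g : Z ⟶ B),
    IsLocalizationOf j ∧ LocallyOfFiniteType g ∧ QuasiCompact g ∧ j ≫ g = f

/-- `X` is a `B`-scheme via `f`: it is separated and essentially of finite type over `B`. -/
def IsBScheme {X B : Scheme.{u}} (f : X ⟶ B) : Prop :=
  IsSeparated f ∧ IsEssFiniteType f

/-- The transcendence degree of the residue field `k(x)` over the residue field `k(f(x))`
(it is `⊤` if infinite). -/
noncomputable def resTrdeg {X B : Scheme.{u}} (f : X ⟶ B) (x : X) : ℕ∞ :=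
  letI : Algebra (B.residueField (f x)) (X.residueField x) := (f.residueFieldMap x).hom.toAlgebra
  Cardinal.toENat (Algebra.trdeg (B.residueField (f x)) (X.residueField x))

/-- A generalized dimension function on the points of `B`: a function with values in the
non-negative integers such that `δ(b) ≥ δ(b') + codim_b b'` whenever `b'` lies in the closure of
`b`. -/
def IsGenDimFunction {B : Scheme.{u}} (δ : B → ℕ) : Prop :=
  ∀ b b' : B, b' ∈ closure {b} → (δ b' : ℕ∞) + codim {b'} (closure {b}) ≤ (δ b : ℕ∞)

/-- The extension of `δ` to the points of schemes over `B`: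
`δ(x) = δ(f(x)) + tr.deg. k(x)/k(f(x))`. -/
noncomputable def deltaPt {X B : Scheme.{u}} (δ : B → ℕ) (f : X ⟶ B) (x : X) : ℕ∞ :=
  (δ (f x) : ℕ∞) + resTrdeg f x

/-- The `δ`-dimension of a scheme over `B`: the supremum of `δ(x)` over its points. As for the
Krull dimension, the supremum over the empty scheme is `⊥` (that is, `-∞`). -/
noncomputable def deltaDim {X B : Scheme.{u}} (δ : B → ℕ) (f : X ⟶ B) : WithBot ℕ∞ :=
  ⨆ x : X, (deltaPt δ f x : WithBot ℕ∞)

/-- For an irreducible component `Bk` of `B` and a point `b` of `Bk`, the integer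
`-codim_{Bk} b`. (The codimension is finite if `B` is of finite Krull dimension, see
`codim_le_topologicalKrullDim`.) -/
noncomputable def componentDelta {B : Scheme.{u}} (Bk : Set B) (b : B) : ℤ :=
  -((codim {b} Bk).toNat : ℤ)

/-- `v : U ⟶ X` is generically of dimension at most `d`: at each generic point `η` of `U` the
dimension of `U` over `X`, i.e. the transcendence degree of `k(η)` over `k(v(η))`, is at most `d`.
(Krull dimensions of fibres would not be adequate for morphisms that are only essentially of finite
type: the spectrum of `k(t)` is of dimension `1` over that of `k`.) -/
def IsGenericallyOfDimLE {U X : Scheme.{u}} (v : U ⟶ X) (d : ℕ) : Prop :=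
  ∀ η ∈ genericPoints U, resTrdeg v η ≤ (d : ℕ∞)

end GenDim

/-! On a sober space the inequality defining a generalized dimension function says only that `δ`
drops strictly under every proper specialization (`StrictSpec`): the generic points of a chain of
irreducible closed sets specialize successively, and conversely a proper specialization has
codimension at least 1. So the codimension inequality on `X` needs no dimension formula; it suffices
that strictness passes from `B` to `X` (`ExtendsStrictSpec`).

Transcendence degrees add up under composition and vanish for preimmersions, so localizations and
closed immersions are harmless. Working locally, this leaves `R → R[X]` with `R` Noetherian
(`extendsStrictSpec_C`). There the transcendence degree is 0 or 1, and the only danger is a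
specialization along which it rises from 0 to 1 while the point of the base moves. Krull's principal
ideal theorem then yields a prime strictly between the two contractions (`exists_prime_between`), so
`δ` drops by at least 2 on the base and strictness survives.

The other claims follow since a `B`-scheme has a Noetherian underlying space: it has finitely many
generic points, every point is a specialization of one of them, and hence `δ(X)` is attained at a
generic point. -/

namespace GenDim

/-! ### Topology: strictly decreasing functions, codimension, generic points. -/

section Topology

variable {T : Type*} [TopologicalSpace T]

/-- A function on the points of a space that strictly decreases under proper specializations. -/
def StrictSpec (δ : T → ℕ) : Prop :=
  ∀ ⦃x y : T⦄, x ⤳ y → x ≠ y → δ y < δ x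

lemma StrictSpec.le {δ : T → ℕ} (h : StrictSpec δ) {x y : T} (hxy : x ⤳ y) : δ y ≤ δ x := by
  by_cases e : x = y
  · rw [e]
  · exact (h hxy e).le

lemma StrictSpec.comp_isEmbedding {S : Type*} [TopologicalSpace S] {δ : T → ℕ}
    (h : StrictSpec δ) {j : S → T} (hj : Topology.IsEmbedding j) : StrictSpec (δ ∘ j) :=
  fun _ _ hxy hne => h (hxy.map hj.continuous) (hj.injective.ne hne)

/-- The irreducible closed subset with a given generic point. -/
def pointClosure (x : T) : IrreducibleCloseds T :=
  ⟨closure {x}, isIrreducible_singleton.closure, isClosed_closure⟩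

/-- The generic point of an irreducible closed subset of a quasi-sober space. -/
noncomputable def genPt [QuasiSober T] (W : IrreducibleCloseds T) : T :=
  W.isIrreducible.genericPoint

lemma closure_genPt [QuasiSober T] (W : IrreducibleCloseds T) : closure {genPt W} = (W : Set T) :=
  W.isIrreducible.isGenericPoint_genericPoint W.isClosed

lemma StrictSpec.strictMono_genPt [QuasiSober T] {δ : T → ℕ} (h : StrictSpec δ) :
    StrictMono fun W : IrreducibleCloseds T => δ (genPt W) := by
  intro V W hVW
  refine h ?_ ?_
  · rw [specializes_iff_mem_closure, closure_genPt]
    apply (show (V : Set T) ⊆ W from hVW.le)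
    rw [← closure_genPt V]
    exact subset_closure rfl
  · intro e
    apply hVW.ne
    apply IrreducibleCloseds.ext
    rw [← closure_genPt V, ← closure_genPt W, e]

lemma StrictSpec.head_add_length_le [QuasiSober T] {δ : T → ℕ} (h : StrictSpec δ)
    (p : LTSeries (IrreducibleCloseds T)) :
    δ (genPt p.head) + p.length ≤ δ (genPt p.last) :=
  LTSeries.head_add_length_le_nat (p.map _ h.strictMono_genPt)

/-- Along the generic points of a chain `δ` changes by at least 1 at each step, so its values at the
two ends bound the length. -/
lemma StrictSpec.add_codim_le [QuasiSober T] {δ : T → ℕ} (h : StrictSpec δ) {x x' : T}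
    (hx : x ⤳ x') : (δ x' : ℕ∞) + codim {x'} (closure {x}) ≤ δ x := by
  have : Nonempty {W : IrreducibleCloseds T // {x'} ⊆ (W : Set T) ∧ (W : Set T) ⊆ closure {x}} :=
    ⟨⟨pointClosure x, by simpa [pointClosure] using hx.mem_closure, subset_rfl⟩⟩
  rw [codim, ENat.add_iSup]
  refine iSup_le fun p => ?_
  have hp : δ (genPt p.head.1) + p.length ≤ δ (genPt p.last.1) :=
    h.head_add_length_le (p.map (fun W => W.1) (fun _ _ h => h))
  have h1 : δ x' ≤ δ (genPt p.head.1) := h.le (by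
    rw [specializes_iff_mem_closure, closure_genPt]
    exact p.head.2.1 rfl)
  have h2 : δ (genPt p.last.1) ≤ δ x := h.le (by
    rw [specializes_iff_mem_closure]
    apply p.last.2.2
    rw [← closure_genPt p.last.1]
    exact subset_closure rfl)
  exact_mod_cast (by omega : δ x' + p.length ≤ δ x)

/-- The two point closures form a chain of length 1, which is strict because distinct points of a T0
space have distinct closures. -/
lemma strictSpec_of_codim_le [T0Space T] {δ : T → ℕ}
    (h : ∀ b b' : T, b' ∈ closure {b} → (δ b' : ℕ∞) + codim {b'} (closure {b}) ≤ (δ b : ℕ∞)) :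
    StrictSpec δ := by
  intro x y hxy hne
  have hlt : (⟨pointClosure y, subset_closure, hxy.closure_subset⟩ :
      {W : IrreducibleCloseds T // {y} ⊆ (W : Set T) ∧ (W : Set T) ⊆ closure {x}}) <
      ⟨pointClosure x, Set.singleton_subset_iff.2 hxy.mem_closure, subset_rfl⟩ := by
    refine lt_of_le_of_ne hxy.closure_subset fun e => hne ?_
    have e' : closure {y} = closure {x} :=
      congrArg (fun W => ((Subtype.val W : IrreducibleCloseds T) : Set T)) e
    exact (inseparable_iff_closure_eq.2 e'.symm).eq
  have h1 : (1 : ℕ∞) ≤ codim {y} (closure {x}) := by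
    refine le_iSup_of_le ((RelSeries.singleton _ _).snoc _ hlt) ?_
    change (1 : ℕ∞) ≤ ((0 + 0 + 1 : ℕ) : ℕ∞)
    simp
  have h2 := (add_le_add_right h1 (δ y : ℕ∞)).trans (h x y hxy.mem_closure)
  exact_mod_cast h2

lemma StrictSpec.topologicalKrullDim_le [QuasiSober T] {δ : T → ℕ} (h : StrictSpec δ) :
    topologicalKrullDim T ≤ ⨆ x, ((δ x : ℕ∞) : WithBot ℕ∞) := by
  refine iSup_le fun p => ?_
  refine le_iSup_of_le (genPt p.last) ?_
  have := h.head_add_length_le p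
  exact_mod_cast (by omega : p.length ≤ δ (genPt p.last))

lemma codim_mono {Z Z' Y : Set T} (h : Z' ⊆ Z) : codim Z Y ≤ codim Z' Y :=
  iSup_le fun p => le_iSup_of_le
    (p.map (fun W => ⟨W.1, h.trans W.2.1, W.2.2⟩) (fun _ _ h => h)) le_rfl

/-- Any chain above `b` can be prolonged at the bottom by the closure of `b'`. -/
lemma codim_add_one_le [T0Space T] {b b' : T} (hb : b ⤳ b') (hne : b ≠ b') {Y : Set T}
    (hY : IsClosed Y) (hbY : b ∈ Y) : codim {b} Y + 1 ≤ codim {b'} Y := by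
  have : Nonempty {W : IrreducibleCloseds T // {b} ⊆ (W : Set T) ∧ (W : Set T) ⊆ Y} :=
    ⟨⟨pointClosure b, subset_closure, closure_minimal (Set.singleton_subset_iff.2 hbY) hY⟩⟩
  rw [codim, ENat.iSup_add]
  refine iSup_le fun p => ?_
  let q : LTSeries {W : IrreducibleCloseds T // {b'} ⊆ (W : Set T) ∧ (W : Set T) ⊆ Y} :=
    p.map (fun W => ⟨W.1, Set.singleton_subset_iff.2
      (hb.mem_closed W.1.isClosed (W.2.1 rfl)), W.2.2⟩) (fun _ _ h => h)
  have hbh : closure {b} ⊆ (p.head.1 : Set T) := closure_minimal p.head.2.1 p.head.1.isClosed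
  have hlt : (⟨pointClosure b', subset_closure,
      (hb.closure_subset.trans hbh).trans p.head.2.2⟩ :
      {W : IrreducibleCloseds T // {b'} ⊆ (W : Set T) ∧ (W : Set T) ⊆ Y}) < q.head := by
    refine lt_of_le_of_ne (show closure {b'} ⊆ (p.head.1 : Set T) from
      hb.closure_subset.trans hbh) fun e => hne ?_
    have e' : closure {b'} = (p.head.1 : Set T) :=
      congrArg (fun W : {W : IrreducibleCloseds T // {b'} ⊆ (W : Set T) ∧ (W : Set T) ⊆ Y} =>
        (W.1 : Set T)) e
    refine (hb.antisymm ?_).eq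
    rw [specializes_iff_mem_closure, e']
    exact p.head.2.1 rfl
  refine le_iSup_of_le (q.cons _ hlt) ?_
  change (p.length : ℕ∞) + 1 ≤ ((0 + p.length + 1 : ℕ) : ℕ∞)
  simp

/-- An irreducible closed set contained in `Y` is recovered from its trace on `Y`, so strict chains
stay strict. This turns `c k ≥ dim` into non-negativity of the constructed function. -/
lemma codim_le_topologicalKrullDim_subspace (Z : Set T) {Y : Set T} (hZ : Z.Nonempty)
    (hZY : Z ⊆ Y) : (codim Z Y : WithBot ℕ∞) ≤ topologicalKrullDim ↥Y := by
  obtain ⟨z, hz⟩ := hZ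
  have : Nonempty (IrreducibleCloseds ↥Y) := ⟨pointClosure ⟨z, hZY hz⟩⟩
  rw [topologicalKrullDim, Order.krullDim_eq_iSup_length, WithBot.coe_le_coe]
  refine iSup_le fun p => ?_
  have key : ∀ W : IrreducibleCloseds T, (W : Set T) ⊆ Y →
      Subtype.val '' ((Subtype.val : Y → T) ⁻¹' (W : Set T)) = (W : Set T) := fun W hW => by
    rw [Subtype.image_preimage_coe, Set.inter_eq_right.2 hW]
  have irr : ∀ W : IrreducibleCloseds T, (W : Set T) ⊆ Y →
      IsIrreducible ((Subtype.val : Y → T) ⁻¹' (W : Set T)) := fun W hW => by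
    obtain ⟨w, hw⟩ := W.isIrreducible.nonempty
    refine ⟨⟨⟨w, hW hw⟩, hw⟩, ?_⟩
    rintro _ _ ⟨U, hU, rfl⟩ ⟨V, hV, rfl⟩ ⟨a, ha, haU⟩ ⟨b, hb, hbV⟩
    obtain ⟨c, hc, hcUV⟩ := W.isIrreducible.isPreirreducible U V hU hV ⟨a, ha, haU⟩ ⟨b, hb, hbV⟩
    exact ⟨⟨c, hW hc⟩, hc, hcUV⟩
  refine le_iSup_of_le (p.map (fun W => (⟨Subtype.val ⁻¹' (W.1 : Set T), irr W.1 W.2.2,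
    W.1.isClosed.preimage continuous_subtype_val⟩ : IrreducibleCloseds ↥Y)) ?_) le_rfl
  intro V W hVW
  refine lt_of_le_of_ne (show Subtype.val ⁻¹' (V.1 : Set T) ⊆ Subtype.val ⁻¹' (W.1 : Set T) from
    Set.preimage_mono hVW.le) fun e => ?_
  refine hVW.ne (Subtype.ext (IrreducibleCloseds.ext ?_))
  rw [← key V.1 V.2.2, ← key W.1 W.2.2]
  exact congrArg (fun S => Subtype.val '' ((S : IrreducibleCloseds ↥Y) : Set ↥Y)) e

lemma exists_genericPoints_specializes [QuasiSober T] (x : T) :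
    ∃ ξ ∈ genericPoints T, ξ ⤳ x := by
  let c : irreducibleComponents T := ⟨_, irreducibleComponent_mem_irreducibleComponents x⟩
  refine ⟨genericPoints.ofComponent c, (genericPoints.ofComponent c).2, ?_⟩
  exact (genericPoints.isGenericPoint_ofComponent c).specializes mem_irreducibleComponent

lemma eq_of_specializes_genericPoints [T0Space T] {ξ y : T} (hξ : ξ ∈ genericPoints T)
    (h : y ⤳ ξ) : y = ξ := by
  have hle := hξ.2 (isIrreducible_singleton (x := y)).closure h.closure_subset
  exact (h.antisymm (specializes_iff_mem_closure.2 (hle (subset_closure rfl)))).eq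

lemma finite_genericPoints [T0Space T] [NoetherianSpace T] : (genericPoints T).Finite :=
  genericPoints.finite NoetherianSpace.finite_irreducibleComponents

/-- With finitely many components, each one contains a nonempty open set. Hence dense open sets
contain all generic points and nowhere dense sets contain none. -/
lemma exists_open_subset_closure_genericPoints [NoetherianSpace T] {ξ : T}
    (hξ : ξ ∈ genericPoints T) : ∃ V : Set T, IsOpen V ∧ ξ ∈ V ∧ V ⊆ closure {ξ} := by
  obtain ⟨V, hV, hne, hVc⟩ := NoetherianSpace.exists_isOpen_nonempty_subset_irreducibleComponent _ hξ
  obtain ⟨y, hy⟩ := hne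
  exact ⟨V, hV, (specializes_iff_mem_closure.2 (hVc hy)).mem_open hV hy, hVc⟩

lemma genericPoints_mem_of_dense [NoetherianSpace T] {ξ : T} (hξ : ξ ∈ genericPoints T)
    {V : Set T} (hV : IsOpen V) (hd : Dense V) : ξ ∈ V := by
  obtain ⟨W, hW, hξW, hWc⟩ := exists_open_subset_closure_genericPoints hξ
  obtain ⟨y, hyW, hyV⟩ := hd.inter_open_nonempty W hW ⟨ξ, hξW⟩
  exact (specializes_iff_mem_closure.2 (hWc hyW)).mem_open hV hyV

lemma notMem_genericPoints_of_isNowhereDense [NoetherianSpace T] {S : Set T}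
    (hS : IsNowhereDense S) {x : T} (hx : x ∈ S) : x ∉ genericPoints T := by
  intro h
  obtain ⟨W, hW, hxW, hWc⟩ := exists_open_subset_closure_genericPoints h
  have : x ∈ interior (closure S) :=
    mem_interior.2 ⟨W, hWc.trans (closure_mono (Set.singleton_subset_iff.2 hx)), hW, hxW⟩
  rw [hS] at this
  exact this

/-- A generic point in the closure of the image is the image of a generic point. -/
lemma exists_genericPoints_map_eq {S : Type*} [TopologicalSpace S] [QuasiSober S] [T0Space S]
    [NoetherianSpace S] [T0Space T] {v : S → T} (hv : Continuous v) (hd : DenseRange v) {ξ : T}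
    (hξ : ξ ∈ genericPoints T) : ∃ η ∈ genericPoints S, v η = ξ := by
  -- Finiteness of the set of generic points makes this union closed, so it contains the closure of
  -- the image.
  have hcl : IsClosed (⋃ η ∈ genericPoints S, closure {v η}) :=
    finite_genericPoints.isClosed_biUnion fun _ _ => isClosed_closure
  have hsub : Set.range v ⊆ ⋃ η ∈ genericPoints S, closure {v η} := by
    rintro _ ⟨x, rfl⟩
    obtain ⟨η, hη, h⟩ := exists_genericPoints_specializes x
    exact Set.mem_biUnion hη (h.map hv).mem_closure
  have := closure_minimal hsub hcl (hd ξ)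
  simp only [Set.mem_iUnion] at this
  obtain ⟨η, hη, h⟩ := this
  exact ⟨η, hη, eq_of_specializes_genericPoints hξ (specializes_iff_mem_closure.2 h)⟩

end Topology

/-! ### Commutative algebra: primes of `R[X]`, transcendence degree and dimension. -/

section Algebra

/-- Both sides equal the transcendence degree of `L` over `A`, since `K` is algebraic over `A` and
`L` over `C`. -/
lemma trdeg_eq_of_isFractionRing (A C K L : Type u) [CommRing A] [IsDomain A] [CommRing C]
    [IsDomain C] [Field K] [Field L] [Algebra A C] [Algebra A K] [Algebra C L] [Algebra K L]
    [Algebra A L] [IsScalarTower A C L] [IsScalarTower A K L] [IsFractionRing A K]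
    [IsFractionRing C L] [FaithfulSMul A C] : Algebra.trdeg A C = Algebra.trdeg K L := by
  have : FaithfulSMul A K := inferInstance
  have : FaithfulSMul C L := inferInstance
  have : Algebra.IsAlgebraic A K := IsLocalization.isAlgebraic _ (nonZeroDivisors A)
  have : Algebra.IsAlgebraic C L := IsLocalization.isAlgebraic _ (nonZeroDivisors C)
  have h1 := trdeg_add_eq A K (A := L)
  have h2 := trdeg_add_eq A C (A := L)
  rw [trdeg_eq_zero, zero_add] at h1
  rw [trdeg_eq_zero (R := C), add_zero] at h2
  rw [h1, h2]

open Polynomial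

lemma map_mk_eq_zero_iff {R : Type*} [CommRing R] (p : Ideal R) (g : R[X]) :
    g.map (Ideal.Quotient.mk p) = 0 ↔ g ∈ p.map C := by
  simp [Polynomial.ext_iff, Ideal.mem_map_C_iff, Ideal.Quotient.eq_zero_iff_mem]

section

variable {R : Type u} [CommRing R] (Q : Ideal R[X])

/-- The residue ring `R[X] ⧸ Q` as an algebra over the residue ring of the contraction of `Q`. -/
noncomputable abbrev quotientPolynomialAlgebra : Algebra (R ⧸ Q.comap C) (R[X] ⧸ Q) :=
  (Ideal.quotientMap Q C le_rfl).toAlgebra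

attribute [local instance] quotientPolynomialAlgebra

lemma aeval_map_mk (g : R[X]) :
    aeval (Ideal.Quotient.mk Q X) (g.map (Ideal.Quotient.mk (Q.comap C))) =
      Ideal.Quotient.mk Q g := by
  have : (algebraMap (R ⧸ Q.comap C) (R[X] ⧸ Q)).comp (Ideal.Quotient.mk (Q.comap C)) =
      (Ideal.Quotient.mk Q).comp C := Ideal.quotientMap_comp_mk le_rfl
  rw [aeval_def, eval₂_map, this, ← hom_eval₂, eval₂_C_X]

lemma aeval_mk_X_surjective :
    Function.Surjective (aeval (R := R ⧸ Q.comap C) (Ideal.Quotient.mk Q X)) := fun y => by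
  obtain ⟨g, rfl⟩ := Ideal.Quotient.mk_surjective y
  exact ⟨_, aeval_map_mk Q g⟩

/-- The class of `X` generates the residue ring; it is transcendental if `Q` is extended from its
contraction, and algebraic otherwise (next lemma). -/
lemma trdeg_quotient_polynomial_of_le [Q.IsPrime] (h : Q ≤ (Q.comap C).map C) :
    Algebra.trdeg (R ⧸ Q.comap C) (R[X] ⧸ Q) = 1 := by
  have ht : Transcendental (R ⧸ Q.comap C) (Ideal.Quotient.mk Q X) := by
    rw [transcendental_iff]
    intro P hP
    obtain ⟨g, rfl⟩ := Polynomial.map_surjective _ Ideal.Quotient.mk_surjective P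
    rw [aeval_map_mk, Ideal.Quotient.eq_zero_iff_mem] at hP
    exact (map_mk_eq_zero_iff _ _).2 (h hP)
  have : Algebra.Transcendental (R ⧸ Q.comap C) (R[X] ⧸ Q) := ⟨_, ht⟩
  refine le_antisymm ?_ (Cardinal.one_le_iff_pos.2 (trdeg_pos _ _))
  refine (trdeg_le_of_surjective _ (aeval_mk_X_surjective Q)).trans ?_
  rw [Polynomial.trdeg_of_isDomain]

lemma trdeg_quotient_polynomial_of_not_le [Q.IsPrime] (h : ¬ Q ≤ (Q.comap C).map C) :
    Algebra.trdeg (R ⧸ Q.comap C) (R[X] ⧸ Q) = 0 := by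
  obtain ⟨g, hgQ, hg⟩ := SetLike.not_le_iff_exists.1 h
  have ht : IsAlgebraic (R ⧸ Q.comap C) (Ideal.Quotient.mk Q X) :=
    ⟨_, fun e => hg ((map_mk_eq_zero_iff _ _).1 e), by
      rw [aeval_map_mk, Ideal.Quotient.eq_zero_iff_mem]
      exact hgQ⟩
  have : Algebra.IsAlgebraic (R ⧸ Q.comap C) (R[X] ⧸ Q) := ⟨fun y => by
    obtain ⟨P, rfl⟩ := aeval_mk_X_surjective Q y
    have hle : Algebra.adjoin (R ⧸ Q.comap C) {Ideal.Quotient.mk Q X} ≤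
        Subalgebra.algebraicClosure (R ⧸ Q.comap C) (R[X] ⧸ Q) :=
      Algebra.adjoin_le (Set.singleton_subset_iff.2 ht)
    exact hle (aeval_mem_adjoin_singleton _ _)⟩
  exact trdeg_eq_zero

/-- Here `R[X] ⧸ Q` is an algebraic domain over its base, so the nonzero image of `Q'` meets the
base nontrivially. -/
lemma comap_C_lt_of_not_le [Q.IsPrime] {Q' : Ideal R[X]} (hlt : Q < Q')
    (h : ¬ Q ≤ (Q.comap C).map C) : Q.comap C < Q'.comap C := by
  have := trdeg_eq_zero_iff.1 (trdeg_quotient_polynomial_of_not_le Q h)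
  obtain ⟨x, hx, hxQ⟩ := SetLike.exists_of_lt hlt
  have hne := Ideal.comap_ne_bot_of_algebraic_mem (R := R ⧸ Q.comap C)
    (I := Q'.map (Ideal.Quotient.mk Q)) (x := Ideal.Quotient.mk Q x)
    (fun e => hxQ (Ideal.Quotient.eq_zero_iff_mem.1 e)) (Ideal.mem_map_of_mem _ hx)
    (Algebra.IsAlgebraic.isAlgebraic _)
  refine lt_of_le_of_ne (Ideal.comap_mono hlt.le) fun e => hne (eq_bot_iff.2 fun y hy => ?_)
  obtain ⟨r, rfl⟩ := Ideal.Quotient.mk_surjective y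
  have hr : C r ∈ (Q'.map (Ideal.Quotient.mk Q)).comap (Ideal.Quotient.mk Q) := hy
  rw [Ideal.comap_map_of_surjective _ Ideal.Quotient.mk_surjective, ← RingHom.ker,
    Ideal.mk_ker, sup_eq_left.2 hlt.le] at hr
  exact Ideal.Quotient.eq_zero_iff_mem.2 (by rw [e]; exact hr)

end

/-- If a prime of `R[X]` lies strictly between the extensions of two primes of a Noetherian
ring `R`, then there is a prime strictly between these. -/
lemma exists_prime_between {R : Type*} [CommRing R] [IsNoetherianRing R] {p p' : Ideal R}
    [p.IsPrime] [p'.IsPrime] {Q : Ideal R[X]} [Q.IsPrime] (h : p.map C < Q) (h' : Q < p'.map C) :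
    ∃ P : Ideal R, P.IsPrime ∧ p < P ∧ P < p' := by
  obtain ⟨g, hgQ, hg⟩ := SetLike.exists_of_lt h
  rw [Ideal.mem_map_C_iff] at hg
  push Not at hg
  obtain ⟨n, hn⟩ := hg
  set a := g.coeff n
  have hap' : a ∈ p' := Ideal.mem_map_C_iff.1 (h'.le hgQ) n
  have hpp' : p ≤ p' := fun x hx => by
    have := Ideal.mem_map_C_iff.1 ((h.trans h').le (Ideal.mem_map_of_mem C hx)) 0
    simpa using this
  have hI : p ⊔ Ideal.span {a} ≤ p' :=
    sup_le hpp' ((Ideal.span_singleton_le_iff_mem _).2 hap')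
  -- `a` is a coefficient, outside `p`, of an element of `Q`. If this minimal prime `P` over `p +
  -- (a)` were `p'`, its extension would be minimal over `p[X] + (a)`, hence of height at most 1
  -- modulo `p[X]`, yet `Q` lies strictly between.
  obtain ⟨P, hP, hPp'⟩ := Ideal.exists_minimalPrimes_le hI
  have haP : a ∈ P := hP.1.2 (Ideal.mem_sup_right (Ideal.mem_span_singleton_self a))
  refine ⟨P, hP.1.1, lt_of_le_of_ne (le_sup_left.trans hP.1.2) fun e => hn (e ▸ haP),
    lt_of_le_of_ne hPp' fun e => ?_⟩
  subst e
  have hprime : (P.map C).IsPrime := Ideal.isPrime_map_C_of_isPrime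
  have hmin : P.map C ∈ (p.map C ⊔ Ideal.span {C a}).minimalPrimes := by
    refine ⟨⟨hprime, sup_le (h.trans h').le
      ((Ideal.span_singleton_le_iff_mem _).2 (Ideal.mem_map_of_mem C haP))⟩, ?_⟩
    rintro N ⟨hN, hle⟩ hNP
    refine Ideal.map_le_iff_le_comap.2 (hP.2 ⟨hN.comap C, sup_le ?_ ?_⟩ ?_)
    · exact Ideal.map_le_iff_le_comap.1 (le_sup_left.trans hle)
    · rw [Ideal.span_singleton_le_iff_mem]
      exact hle (Ideal.mem_sup_right (Ideal.mem_span_singleton_self _))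
    · intro x hx
      have := Ideal.mem_map_C_iff.1 (hNP hx) 0
      simpa using this
  have hht := Ideal.map_height_le_one_of_mem_minimalPrimes hmin
  have hp0 : (p.map C).IsPrime := Ideal.isPrime_map_C_of_isPrime
  have hQ1 : (Q.map (Ideal.Quotient.mk (p.map C))).IsPrime :=
    Ideal.map_isPrime_of_surjective Ideal.Quotient.mk_surjective (by rw [Ideal.mk_ker]; exact h.le)
  have hP1 : ((P.map C).map (Ideal.Quotient.mk (p.map C))).IsPrime :=
    Ideal.map_isPrime_of_surjective Ideal.Quotient.mk_surjective
      (by rw [Ideal.mk_ker]; exact (h.trans h').le)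
  have key : ∀ J : Ideal R[X], p.map C ≤ J →
      (J.map (Ideal.Quotient.mk (p.map C))).comap (Ideal.Quotient.mk (p.map C)) = J := by
    intro J hJ
    rw [Ideal.comap_map_of_surjective _ Ideal.Quotient.mk_surjective, ← RingHom.ker,
      Ideal.mk_ker, sup_eq_left.2 hJ]
  have hlt2 : Q.map (Ideal.Quotient.mk (p.map C)) <
      (P.map C).map (Ideal.Quotient.mk (p.map C)) := by
    refine lt_of_le_of_ne (Ideal.map_mono h'.le) fun e => h'.ne ?_
    rw [← key Q h.le, e, key _ (h.trans h').le]
  have hlt1 : ⊥ < Q.map (Ideal.Quotient.mk (p.map C)) := by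
    refine bot_lt_iff_ne_bot.2 fun e => h.ne ?_
    rw [← key Q h.le, e, ← RingHom.ker, Ideal.mk_ker]
  have h3 := Ideal.height_add_one_le_of_lt_of_isPrime hlt2
  have h4 := Ideal.height_add_one_le_of_lt_of_isPrime hlt1
  have h5 : (1 : ℕ∞) + 1 ≤ 1 := calc
    (1 : ℕ∞) + 1 ≤ (⊥ : Ideal (R[X] ⧸ p.map C)).height + 1 + 1 := by
      gcongr; exact le_add_self
    _ ≤ _ := (add_le_add_left h4 1).trans (h3.trans hht)
  exact absurd h5 (by norm_num)

/-- By Noether normalization `D` is integral over a polynomial ring in `s` variables, where `s` is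
the transcendence degree; going up lifts chains of primes to `D`. -/
lemma natCast_trdeg_le_ringKrullDim (k D : Type u) [Field k] [CommRing D] [IsDomain D] [Algebra k D]
    [Algebra.FiniteType k D] {n : ℕ} (hn : (n : ℕ∞) ≤ Cardinal.toENat (Algebra.trdeg k D)) :
    (n : WithBot ℕ∞) ≤ ringKrullDim D := by
  obtain ⟨s, g, hg, hint⟩ := exists_integral_inj_algHom_of_fg k D
  let := g.toRingHom.toAlgebra
  have : IsScalarTower k (MvPolynomial (Fin s) k) D := IsScalarTower.of_algebraMap_eq fun x =>
    (g.commutes x).symm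
  have hI : Algebra.IsIntegral (MvPolynomial (Fin s) k) D := ⟨hint⟩
  have hF : FaithfulSMul (MvPolynomial (Fin s) k) D :=
    (faithfulSMul_iff_algebraMap_injective _ _).2 hg
  have h1 := trdeg_add_eq k (MvPolynomial (Fin s) k) (A := D)
  rw [trdeg_eq_zero (R := MvPolynomial (Fin s) k), add_zero,
    MvPolynomial.trdeg_of_isDomain] at h1
  rw [← h1] at hn
  have hns : n ≤ s := by simpa using hn
  have hdim : ringKrullDim (MvPolynomial (Fin s) k) = s := by simp
  have hle : ringKrullDim (MvPolynomial (Fin s) k) ≤ ringKrullDim D := by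
    refine iSup_le fun l => ?_
    obtain ⟨P, hP⟩ := Algebra.IsIntegral.comap_surjective (MvPolynomial (Fin s) k) D l.head
    have : P.asIdeal.LiesOver l.head.asIdeal := ⟨by rw [← hP]; rfl⟩
    obtain ⟨L, hL, -⟩ := Ideal.exists_ltSeries_of_hasGoingUp l P.asIdeal
    rw [← hL]
    exact le_iSup (fun q : LTSeries (PrimeSpectrum D) => (q.length : WithBot ℕ∞)) L
  rw [hdim] at hle
  exact le_trans (by exact_mod_cast hns) hle

end Algebra

/-! ### Transcendence degrees of residue field extensions. -/

section ResidueFields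

variable {X Y Z : Scheme.{u}}

lemma resTrdeg_comp (f : X ⟶ Y) (g : Y ⟶ Z) (x : X) :
    resTrdeg (f ≫ g) x = resTrdeg f x + resTrdeg g (f x) := by
  let a1 : Algebra (Z.residueField (g (f x))) (Y.residueField (f x)) :=
    (g.residueFieldMap (f x)).hom.toAlgebra
  let a2 : Algebra (Y.residueField (f x)) (X.residueField x) :=
    (f.residueFieldMap x).hom.toAlgebra
  let a3 : Algebra (Z.residueField (g (f x))) (X.residueField x) :=
    ((f ≫ g).residueFieldMap x).hom.toAlgebra
  have : IsScalarTower (Z.residueField (g (f x))) (Y.residueField (f x)) (X.residueField x) :=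
    IsScalarTower.of_algebraMap_eq' (by
      have := congrArg CommRingCat.Hom.hom (Scheme.residueFieldMap_comp f g x)
      exact this)
  have h := trdeg_add_eq (Z.residueField (g (f x))) (Y.residueField (f x))
    (A := X.residueField x)
  change Cardinal.toENat (Algebra.trdeg (Z.residueField (g (f x))) (X.residueField x)) = _
  rw [← h, map_add, add_comm]
  rfl

lemma resTrdeg_eq_zero_of_surjective (f : X ⟶ Y) (x : X)
    (h : Function.Surjective (f.stalkMap x)) : resTrdeg f x = 0 := by
  let a : Algebra (Y.residueField (f x)) (X.residueField x) :=
    (f.residueFieldMap x).hom.toAlgebra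
  have hs : Function.Surjective (algebraMap (Y.residueField (f x)) (X.residueField x)) := by
    intro y
    obtain ⟨z, rfl⟩ := X.residue_surjective x y
    obtain ⟨w, rfl⟩ := h z
    refine ⟨Y.residue (f x) w, ?_⟩
    have := congrArg (fun k => k.hom w) (Scheme.residue_residueFieldMap f x)
    exact this
  have : Algebra.IsAlgebraic (Y.residueField (f x)) (X.residueField x) := ⟨fun y => by
    obtain ⟨z, rfl⟩ := hs y
    exact isAlgebraic_algebraMap z⟩
  change Cardinal.toENat (Algebra.trdeg (Y.residueField (f x)) (X.residueField x)) = 0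
  rw [trdeg_eq_zero, map_zero]

lemma resTrdeg_eq_zero (f : X ⟶ Y) [IsPreimmersion f] (x : X) : resTrdeg f x = 0 :=
  resTrdeg_eq_zero_of_surjective f x (f.stalkMap_surjective x)

lemma resTrdeg_congr {f g : X ⟶ Y} (h : f = g) (x : X) : resTrdeg f x = resTrdeg g x := by
  rw [h]

/-- The evaluation homomorphism of a ring to a residue field of its spectrum. -/
noncomputable def specEval (R : CommRingCat.{u}) (p : Spec R) : R ⟶ (Spec R).residueField p :=
  haveI := p.isPrime
  CommRingCat.ofHom (algebraMap R p.asIdeal.ResidueField) ≫ (Scheme.Spec.residueFieldIso R p).inv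

lemma SpecMap_specEval (R : CommRingCat.{u}) (p : Spec R) :
    Spec.map (specEval R p) = (Spec R).fromSpecResidueField p := by
  rw [specEval, Spec.map_comp]
  exact Scheme.Spec.map_residueFieldIso_inv_eq_fromSpecResidueField R p

lemma specEval_residueFieldMap {R S : CommRingCat.{u}} (φ : R ⟶ S) (q : Spec S) :
    specEval R (Spec.map φ q) ≫ (Spec.map φ).residueFieldMap q = φ ≫ specEval S q := by
  apply Spec.map_injective
  rw [Spec.map_comp, Spec.map_comp, SpecMap_specEval, SpecMap_specEval]
  exact Scheme.Hom.SpecMap_residueFieldMap_fromSpecResidueField (Spec.map φ) q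

lemma exists_specEval_algebra (R : CommRingCat.{u}) (p : Spec R) :
    ∃ a : (R ⧸ p.asIdeal) →+* (Spec R).residueField p,
      a.comp (Ideal.Quotient.mk p.asIdeal) = (specEval R p).hom ∧
      (letI := a.toAlgebra; IsFractionRing (R ⧸ p.asIdeal) ((Spec R).residueField p)) := by
  have := p.isPrime
  let e : p.asIdeal.ResidueField ≃+* (Spec R).residueField p :=
    (Scheme.Spec.residueFieldIso R p).symm.commRingCatIsoToRingEquiv
  let a : (R ⧸ p.asIdeal) →+* (Spec R).residueField p :=
    (e : p.asIdeal.ResidueField →+* _).comp (algebraMap (R ⧸ p.asIdeal) p.asIdeal.ResidueField)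
  refine ⟨a, rfl, ?_⟩
  let _ := a.toAlgebra
  exact IsLocalization.isLocalization_of_algEquiv _
    (AlgEquiv.ofRingEquiv (f := e) (fun _ => rfl) :
      p.asIdeal.ResidueField ≃ₐ[R ⧸ p.asIdeal] (Spec R).residueField p)

/-- Residue fields of a spectrum are fraction fields of the residue domains, so the degree can be
computed on the domains. -/
lemma resTrdeg_SpecMap {R S : CommRingCat.{u}} (φ : R ⟶ S) (q : Spec S) :
    letI := (Ideal.quotientMap q.asIdeal φ.hom le_rfl).toAlgebra
    resTrdeg (Spec.map φ) q = Cardinal.toENat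
      (Algebra.trdeg (R ⧸ q.asIdeal.comap φ.hom) (S ⧸ q.asIdeal)) := by
  have hq := q.isPrime
  have hp : (q.asIdeal.comap φ.hom).IsPrime := hq.comap _
  obtain ⟨a, ha, hafr⟩ := exists_specEval_algebra R (Spec.map φ q)
  obtain ⟨c, hc, hcfr⟩ := exists_specEval_algebra S q
  have sq := congrArg CommRingCat.Hom.hom (specEval_residueFieldMap φ q)
  change ((Spec.map φ).residueFieldMap q).hom.comp (specEval R (Spec.map φ q)).hom =
    (specEval S q).hom.comp φ.hom at sq
  rw [← ha, ← hc] at sq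
  let A := R ⧸ q.asIdeal.comap φ.hom
  let C := S ⧸ q.asIdeal
  let K := (Spec R).residueField (Spec.map φ q)
  let L := (Spec S).residueField q
  let i1 : Algebra A C := (Ideal.quotientMap q.asIdeal φ.hom le_rfl).toAlgebra
  let i2 : Algebra A K := RingHom.toAlgebra (R := A) a
  let i3 : Algebra C L := c.toAlgebra
  let i4 : Algebra K L := ((Spec.map φ).residueFieldMap q).hom.toAlgebra
  let i5 : Algebra A L := (c.comp (Ideal.quotientMap q.asIdeal φ.hom le_rfl)).toAlgebra
  have t1 : IsScalarTower A C L := IsScalarTower.of_algebraMap_eq' rfl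
  have t2 : IsScalarTower A K L := IsScalarTower.of_algebraMap_eq' (by
    refine Ideal.Quotient.ringHom_ext ?_
    exact sq.symm)
  have f1 : IsFractionRing A K := hafr
  have f2 : IsFractionRing C L := hcfr
  have f3 : FaithfulSMul A C := (faithfulSMul_iff_algebraMap_injective _ _).2
    (Ideal.quotientMap_injective (I := q.asIdeal) (f := φ.hom))
  exact congrArg Cardinal.toENat (trdeg_eq_of_isFractionRing A C K L).symm

end ResidueFields

/-! ### Strictness passes along morphisms essentially of finite type. -/

section Extension

/-- The natural number `δ(f(x)) + tr.deg. k(x)/k(f(x))`, meaningful if the transcendence degree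
is finite. -/
noncomputable def extendDelta {X B : Scheme.{u}} (δ : B → ℕ) (f : X ⟶ B) (x : X) : ℕ :=
  δ (f x) + (resTrdeg f x).toNat

/-- The residue field extensions of `f` have finite transcendence degrees, and `f` extends
functions that strictly decrease under proper specializations to such functions. -/
def ExtendsStrictSpec {X B : Scheme.{u}} (f : X ⟶ B) : Prop :=
  (∀ x, resTrdeg f x ≠ ⊤) ∧ ∀ δ : B → ℕ, StrictSpec δ → StrictSpec (extendDelta δ f)

/-- Quantifying over all `δ` on the target pays off here: extending along `f ≫ g` is extending along
`g`, then along `f`. -/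
lemma ExtendsStrictSpec.comp {X Y Z : Scheme.{u}} {f : X ⟶ Y} {g : Y ⟶ Z}
    (hf : ExtendsStrictSpec f) (hg : ExtendsStrictSpec g) : ExtendsStrictSpec (f ≫ g) := by
  refine ⟨fun x => ?_, fun δ hδ => ?_⟩
  · rw [resTrdeg_comp]
    exact WithTop.add_ne_top.2 ⟨hf.1 x, hg.1 _⟩
  · have : extendDelta δ (f ≫ g) = extendDelta (extendDelta δ g) f := by
      funext x
      have h : (resTrdeg (f ≫ g) x).toNat = (resTrdeg f x).toNat + (resTrdeg g (f x)).toNat := by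
        rw [resTrdeg_comp, ENat.toNat_add (hf.1 x) (hg.1 _)]
      simp only [extendDelta, h]
      rw [Scheme.Hom.comp_apply]
      omega
    rw [this]
    exact hf.2 _ (hg.2 _ hδ)

lemma ExtendsStrictSpec.of_isPreimmersion {X Y : Scheme.{u}} (f : X ⟶ Y) [IsPreimmersion f] :
    ExtendsStrictSpec f := by
  refine ⟨fun x => by simp [resTrdeg_eq_zero], fun δ hδ => ?_⟩
  have : extendDelta δ f = δ ∘ f := by
    funext x
    simp [extendDelta, resTrdeg_eq_zero]
  rw [this]
  exact hδ.comp_isEmbedding f.isEmbedding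

open Polynomial in
lemma resTrdeg_SpecMap_C {R : Type u} [CommRing R] (Q : Spec (.of R[X])) :
    (Q.asIdeal ≤ (Q.asIdeal.comap C).map C →
      resTrdeg (Spec.map (CommRingCat.ofHom (C : R →+* R[X]))) Q = 1) ∧
    (¬ Q.asIdeal ≤ (Q.asIdeal.comap C).map C →
      resTrdeg (Spec.map (CommRingCat.ofHom (C : R →+* R[X]))) Q = 0) := by
  have hQ := Q.isPrime
  rw [resTrdeg_SpecMap]
  constructor
  · intro h
    have := trdeg_quotient_polynomial_of_le Q.asIdeal h
    exact (congrArg Cardinal.toENat this).trans (map_one _)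
  · intro h
    have := trdeg_quotient_polynomial_of_not_le Q.asIdeal h
    exact (congrArg Cardinal.toENat this).trans (map_zero _)

open Polynomial in
lemma extendsStrictSpec_C (R : Type u) [CommRing R] [IsNoetherianRing R] :
    ExtendsStrictSpec (Spec.map (CommRingCat.ofHom (C : R →+* R[X]))) := by
  set f := Spec.map (CommRingCat.ofHom (C : R →+* R[X]))
  have h0 : ∀ Q : Spec (.of R[X]), resTrdeg f Q = 0 ∨ resTrdeg f Q = 1 := fun Q => by
    by_cases h : Q.asIdeal ≤ (Q.asIdeal.comap C).map C
    · exact Or.inr ((resTrdeg_SpecMap_C Q).1 h)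
    · exact Or.inl ((resTrdeg_SpecMap_C Q).2 h)
  have hle : ∀ Q : Spec (.of R[X]), (Q.asIdeal.comap C).map C ≤ Q.asIdeal :=
    fun Q => Ideal.map_comap_le
  refine ⟨fun Q => by rcases h0 Q with h | h <;> rw [h] <;> simp, fun δ hδ P Q hPQ hne => ?_⟩
  have hP := P.isPrime
  have hQ := Q.isPrime
  have hPQ' : P.asIdeal ≤ Q.asIdeal := (PrimeSpectrum.le_iff_specializes P Q).2 hPQ
  have hlt : P.asIdeal < Q.asIdeal :=
    lt_of_le_of_ne hPQ' fun e => hne (PrimeSpectrum.ext e)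
  have hfPQ : f P ⤳ f Q := hPQ.map f.continuous
  have hfle : P.asIdeal.comap C ≤ Q.asIdeal.comap C := Ideal.comap_mono hPQ'
  simp only [extendDelta]
  -- Within one fibre, `P` must be the extended prime and `Q` a larger one, so the transcendence
  -- degree drops from 1 to 0.
  by_cases hf : f P = f Q
  · have e : P.asIdeal.comap C = Q.asIdeal.comap C := congrArg PrimeSpectrum.asIdeal hf
    have hQ0 : ¬ Q.asIdeal ≤ (Q.asIdeal.comap C).map C := fun h =>
      hlt.not_ge (h.trans (by rw [← e]; exact hle P))
    have hQ1 : resTrdeg f Q = 0 := (resTrdeg_SpecMap_C Q).2 hQ0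
    have hP0 : P.asIdeal ≤ (P.asIdeal.comap C).map C := by
      by_contra h
      exact (comap_C_lt_of_not_le P.asIdeal hlt h).ne e
    have hP1 : resTrdeg f P = 1 := (resTrdeg_SpecMap_C P).1 hP0
    rw [hQ1, hP1, hf]
    simp
  · have h1 := hδ hfPQ hf
    rcases h0 P with hP0 | hP1
    swap
    · rcases h0 Q with hQ0 | hQ0 <;> rw [hP1, hQ0] <;> simp <;> omega
    rcases h0 Q with hQ0 | hQ1
    · rw [hP0, hQ0]; simpa using h1
    -- The critical case: the degree rises from 0 to 1. Then `P` is not extended but `Q` is, and a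
    -- prime `J` between the contractions gives a drop of at least 2 on the base, which outweighs
    -- the rise.
    have hP2 : (P.asIdeal.comap C).map C < P.asIdeal := by
      refine lt_of_le_of_ne (hle P) fun e => ?_
      have := (resTrdeg_SpecMap_C P).1 e.ge
      simp [f, this] at hP0
    have hQ2 : Q.asIdeal = (Q.asIdeal.comap C).map C := by
      refine le_antisymm ?_ (hle Q)
      by_contra h
      have := (resTrdeg_SpecMap_C Q).2 h
      simp [f, this] at hQ1
    have hPp : (P.asIdeal.comap C).IsPrime := hP.comap C
    have hQp : (Q.asIdeal.comap C).IsPrime := hQ.comap C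
    obtain ⟨J, hJ, hPJ, hJQ⟩ := exists_prime_between hP2 (hlt.trans_eq hQ2)
    let j : Spec (.of R) := ⟨J, hJ⟩
    have a1 : f P ⤳ j := (PrimeSpectrum.le_iff_specializes (R := R) (f P) j).1 hPJ.le
    have a2 : j ⤳ f Q := (PrimeSpectrum.le_iff_specializes (R := R) j (f Q)).1 hJQ.le
    have b1 := hδ a1 fun e => hPJ.ne (congrArg PrimeSpectrum.asIdeal e)
    have b2 := hδ a2 fun e => hJQ.ne (congrArg PrimeSpectrum.asIdeal e)
    rw [hP0, hQ1]
    simp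
    omega

lemma extendsStrictSpec_SpecMap {R S : Type u} [CommRing R] [CommRing S] [IsNoetherianRing R]
    (φ : R →+* S) (hφ : φ.FiniteType) : ExtendsStrictSpec (Spec.map (CommRingCat.ofHom φ)) := by
  -- Noetherianity of the target is carried through the induction because the polynomial step needs
  -- a Noetherian base.
  let P : ∀ (R : Type u) [CommRing R] (S : Type u) [CommRing S], (R →+* S) → Prop :=
    fun R _ S _ φ => IsNoetherianRing R → IsNoetherianRing S ∧
      ExtendsStrictSpec (Spec.map (CommRingCat.ofHom φ))
  have := RingHom.FinitePresentation.polynomial_induction P P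
    (fun R _ _ => ⟨inferInstance, extendsStrictSpec_C R⟩)
    (fun R _ S _ f hf _ _ => ⟨isNoetherianRing_of_surjective R S f hf, by
      have : IsClosedImmersion (Spec.map (CommRingCat.ofHom f)) :=
        IsClosedImmersion.spec_of_surjective _ hf
      exact ExtendsStrictSpec.of_isPreimmersion _⟩)
    (fun R _ S _ T _ f g hf hg hR => by
      have h1 := hf hR
      have h2 := hg h1.1
      refine ⟨h2.1, ?_⟩
      rw [CommRingCat.ofHom_comp, Spec.map_comp]
      exact h2.2.comp h1.2)
    φ (RingHom.FinitePresentation.of_finiteType.1 hφ)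
  exact (this inferInstance).2

lemma ExtendsStrictSpec.of_locallyOfFiniteType {X B : Scheme.{u}} [IsLocallyNoetherian B]
    (f : X ⟶ B) [LocallyOfFiniteType f] : ExtendsStrictSpec f := by
  have key : ∀ y : X, ∃ (R S : CommRingCat.{u}) (φ : R ⟶ S) (i : Spec R ⟶ B) (j : Spec S ⟶ X),
      ExtendsStrictSpec (Spec.map φ) ∧ IsOpenImmersion i ∧ IsOpenImmersion j ∧
        j ≫ f = Spec.map φ ≫ i ∧ y ∈ Set.range j := by
    intro y
    obtain ⟨V, hV, hyV, -⟩ := exists_isAffineOpen_mem_and_subset (X := B) (x := f y) (U := ⊤) trivial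
    obtain ⟨W, hW, hyW, hWV⟩ := exists_isAffineOpen_mem_and_subset (X := X) (x := y) (U := f ⁻¹ᵁ V) hyV
    have hN : IsNoetherianRing Γ(B, V) := IsLocallyNoetherian.component_noetherian ⟨V, hV⟩
    refine ⟨_, _, f.appLE V W hWV, hV.fromSpec, hW.fromSpec, ?_, inferInstance, inferInstance,
      (hV.SpecMap_appLE_fromSpec f hW hWV).symm, ?_⟩
    · exact extendsStrictSpec_SpecMap _ (f.finiteType_appLE hV hW hWV)
    · rw [hW.range_fromSpec]
      exact hyW
  refine ⟨fun y => ?_, fun δ hδ x y hxy hne => ?_⟩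
  · obtain ⟨R, S, φ, i, j, h, hi, hj, e, y, rfl⟩ := key y
    have := resTrdeg_congr e y
    rw [resTrdeg_comp, resTrdeg_comp, resTrdeg_eq_zero j, resTrdeg_eq_zero i, zero_add,
      add_zero] at this
    rw [this]
    exact h.1 y
  · obtain ⟨R, S, φ, i, j, h, hi, hj, e, y, rfl⟩ := key y
    -- Open sets are stable under generization, so a chart around `y` also contains `x`.
    obtain ⟨x, rfl⟩ : x ∈ Set.range j := hxy.mem_open j.isOpenEmbedding.isOpen_range ⟨y, rfl⟩
    have hc : ∀ z, extendDelta δ f (j z) = extendDelta δ (j ≫ f) z := fun z => by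
      simp [extendDelta, resTrdeg_comp, resTrdeg_eq_zero]
    rw [hc, hc, e]
    exact (h.comp (.of_isPreimmersion i)).2 δ hδ (j.isEmbedding.toIsInducing.specializes_iff.1 hxy)
      fun e => hne (by rw [e])

end Extension

/-! ### Fibre dimension bounds the residue transcendence degree. -/

lemma resTrdeg_SpecMap_le_of_ringKrullDim_le {k S : CommRingCat.{u}} (hk : IsField k) (φ : k ⟶ S)
    (hφ : φ.hom.FiniteType) {d : ℕ} (hd : ringKrullDim S ≤ (d : WithBot ℕ∞)) (q : Spec S) :
    resTrdeg (Spec.map φ) q ≤ d := by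
  have hq := q.isPrime
  let _ : Field k := hk.toField
  have hmax : (q.asIdeal.comap φ.hom).IsMaximal := by
    have : (q.asIdeal.comap φ.hom).IsPrime := hq.comap _
    rw [Ideal.eq_bot_of_prime (q.asIdeal.comap φ.hom)]
    exact Ideal.bot_isMaximal
  let _ : Field (k ⧸ q.asIdeal.comap φ.hom) := Ideal.Quotient.field _
  let _ : Algebra (k ⧸ q.asIdeal.comap φ.hom) (S ⧸ q.asIdeal) :=
    (Ideal.quotientMap q.asIdeal φ.hom le_rfl).toAlgebra
  have hft : (Ideal.quotientMap q.asIdeal φ.hom le_rfl).FiniteType := by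
    refine RingHom.FiniteType.of_comp_finiteType (f := Ideal.Quotient.mk _) ?_
    rw [Ideal.quotientMap_comp_mk]
    exact (RingHom.FiniteType.of_surjective _ Ideal.Quotient.mk_surjective).comp hφ
  have : Algebra.FiniteType (k ⧸ q.asIdeal.comap φ.hom) (S ⧸ q.asIdeal) := hft
  by_contra! hlt
  -- Bounding by the natural number `d + 1` also covers an infinite transcendence degree.
  have h1 : ((d + 1 : ℕ) : ℕ∞) ≤ resTrdeg (Spec.map φ) q := by
    push_cast
    exact Order.add_one_le_of_lt hlt
  rw [resTrdeg_SpecMap] at h1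
  have h2 := natCast_trdeg_le_ringKrullDim (k ⧸ q.asIdeal.comap φ.hom) (S ⧸ q.asIdeal) h1
  have h3 := (h2.trans (ringKrullDim_quotient_le q.asIdeal)).trans hd
  have h4 : d + 1 ≤ d := by exact_mod_cast h3
  omega

/-- The degree can be computed in the scheme-theoretic fibre, on an affine open part lying over `V`;
that part is homeomorphic to a subspace of the given set, so its dimension is no larger. -/
lemma resTrdeg_le_of_topologicalKrullDim_fiber_le {U X : Scheme.{u}} (v : U ⟶ X)
    [LocallyOfFiniteType v] (V : U.Opens) {d : ℕ} (η : U) (hη : η ∈ V)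
    (hd : topologicalKrullDim ↥((V : Set U) ∩ v ⁻¹' {v η}) ≤ (d : WithBot ℕ∞)) :
    resTrdeg v η ≤ d := by
  let ι := v.fiberι (v η)
  let π := v.fiberToSpecResidueField (v η)
  have hπ : LocallyOfFiniteType π := inferInstanceAs
    (LocallyOfFiniteType (Limits.pullback.snd v (X.fromSpecResidueField (v η))))
  have h1 : resTrdeg v η = resTrdeg π (v.asFiber η) := by
    have h := resTrdeg_congr (v.fiber_fac (v η)) (v.asFiber η)
    rw [resTrdeg_comp, resTrdeg_comp, resTrdeg_eq_zero (v.fiberι _),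
      resTrdeg_eq_zero (X.fromSpecResidueField _), zero_add, add_zero] at h
    rw [← h, v.fiberι_asFiber]
  obtain ⟨W, hW, hηW, hWV⟩ := exists_isAffineOpen_mem_and_subset (x := v.asFiber η) (U := ι ⁻¹ᵁ V)
    (by change ι _ ∈ V; rw [v.fiberι_asFiber]; exact hη)
  let j := hW.fromSpec
  obtain ⟨q, hq⟩ : v.asFiber η ∈ Set.range j := by
    rw [hW.range_fromSpec]
    exact hηW
  obtain ⟨φ, hφ⟩ := Spec.map_surjective (j ≫ π)
  have hft : φ.hom.FiniteType := by
    rw [← HasRingHomProperty.Spec_iff (P := @LocallyOfFiniteType), hφ]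
    infer_instance
  rw [h1, ← hq]
  have h2 : resTrdeg π (j q) = resTrdeg (Spec.map φ) q := by
    rw [hφ, resTrdeg_comp, resTrdeg_eq_zero j, zero_add]
  rw [h2]
  refine resTrdeg_SpecMap_le_of_ringKrullDim_le (Field.toIsField (X.residueField (v η))) φ hft ?_ q
  have hmem : ∀ s, (j ≫ ι) s ∈ (V : Set U) ∩ v ⁻¹' {v η} := fun s => by
    constructor
    · apply hWV
      exact hW.range_fromSpec.subset ⟨s, rfl⟩
    · have : ι (j s) ∈ Set.range (v.fiberι (v η)) := ⟨_, rfl⟩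
      rw [v.range_fiberι] at this
      exact this
  have hemb : Topology.IsInducing (Set.codRestrict (j ≫ ι) _ hmem) :=
    ((j ≫ ι).isEmbedding.codRestrict _ hmem).toIsInducing
  rw [← PrimeSpectrum.topologicalKrullDim_eq_ringKrullDim]
  exact hemb.topologicalKrullDim_le.trans hd

/-! ### The `δ`-dimension of a `B`-scheme. -/

section BScheme

variable {X B : Scheme.{u}}

lemma IsLocalizationOf.isPreimmersion {Z : Scheme.{u}} {j : X ⟶ Z} (hj : IsLocalizationOf j) :
    IsPreimmersion j where
  stalkMap_surjective x := by
    have := hj.2 x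
    exact (ConcreteCategory.bijective_of_isIso (j.stalkMap x)).2
  isEmbedding := hj.1

lemma IsEssFiniteType.extendsStrictSpec [IsLocallyNoetherian B] {f : X ⟶ B}
    (hf : IsEssFiniteType f) : ExtendsStrictSpec f := by
  obtain ⟨Z, j, g, hj, hg, -, rfl⟩ := hf
  have := hj.isPreimmersion
  exact (ExtendsStrictSpec.of_isPreimmersion j).comp (.of_locallyOfFiniteType g)

lemma IsEssFiniteType.noetherianSpace [IsNoetherian B] {f : X ⟶ B} (hf : IsEssFiniteType f) :
    NoetherianSpace X := by
  obtain ⟨Z, j, g, hj, hg, hqc, rfl⟩ := hf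
  have : IsLocallyNoetherian Z := LocallyOfFiniteType.isLocallyNoetherian g
  have : CompactSpace Z := QuasiCompact.compactSpace_of_compactSpace g
  have : IsNoetherian Z := {}
  exact hj.1.toIsInducing.noetherianSpace

lemma ExtendsStrictSpec.deltaPt_eq {f : X ⟶ B} (hf : ExtendsStrictSpec f) (δ : B → ℕ) (x : X) :
    deltaPt δ f x = (extendDelta δ f x : ℕ∞) := by
  rw [deltaPt, extendDelta, ENat.natCast_add, ENat.natCast_toNat (hf.1 x)]

lemma deltaPt_comp {U : Scheme.{u}} (δ : B → ℕ) (v : U ⟶ X) (f : X ⟶ B) (x : U) :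
    deltaPt δ (v ≫ f) x = deltaPt δ f (v x) + resTrdeg v x := by
  rw [deltaPt, deltaPt, resTrdeg_comp, Scheme.Hom.comp_apply, add_comm (resTrdeg v x), add_assoc]

lemma deltaPt_le_deltaDim (δ : B → ℕ) (f : X ⟶ B) (x : X) :
    (deltaPt δ f x : WithBot ℕ∞) ≤ deltaDim δ f :=
  le_iSup (fun x : X => (deltaPt δ f x : WithBot ℕ∞)) x

lemma IsEssFiniteType.deltaPt_le_of_specializes [IsLocallyNoetherian B] {δ : B → ℕ}
    (hδ : StrictSpec δ) {f : X ⟶ B}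
    (hf : IsEssFiniteType f) {x y : X} (h : x ⤳ y) : deltaPt δ f y ≤ deltaPt δ f x := by
  rw [hf.extendsStrictSpec.deltaPt_eq, hf.extendsStrictSpec.deltaPt_eq]
  exact_mod_cast (hf.extendsStrictSpec.2 δ hδ).le h

lemma deltaDim_le [IsLocallyNoetherian B] {δ : B → ℕ} (hδ : StrictSpec δ) {f : X ⟶ B}
    (hf : IsEssFiniteType f) {n : WithBot ℕ∞}
    (h : ∀ η ∈ genericPoints X, (deltaPt δ f η : WithBot ℕ∞) ≤ n) : deltaDim δ f ≤ n := by
  refine iSup_le fun x => ?_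
  obtain ⟨η, hη, hx⟩ := exists_genericPoints_specializes x
  exact (WithBot.coe_le_coe.2 (hf.deltaPt_le_of_specializes hδ hx)).trans (h η hη)

lemma exists_deltaDim_eq [IsNoetherian B] {δ : B → ℕ} (hδ : StrictSpec δ) {f : X ⟶ B}
    (hf : IsEssFiniteType f) [Nonempty X] :
    ∃ η ∈ genericPoints X, deltaDim δ f = (deltaPt δ f η : WithBot ℕ∞) := by
  have := hf.noetherianSpace
  obtain ⟨x⟩ := ‹Nonempty X›
  obtain ⟨ξ, hξ, -⟩ := exists_genericPoints_specializes x
  obtain ⟨η, hη, hmax⟩ := (finite_genericPoints (T := X)).exists_maximalFor (deltaPt δ f)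
    (genericPoints X) ⟨ξ, hξ⟩
  refine ⟨η, hη, le_antisymm (deltaDim_le hδ hf fun ζ hζ => ?_) (deltaPt_le_deltaDim _ _ _)⟩
  rw [WithBot.coe_le_coe]
  rcases le_total (deltaPt δ f ζ) (deltaPt δ f η) with h | h
  · exact h
  · exact hmax hζ h

lemma IsEssFiniteType.deltaPt_lt_of_specializes [IsLocallyNoetherian B] {δ : B → ℕ}
    (hδ : StrictSpec δ) {f : X ⟶ B} (hf : IsEssFiniteType f) {x y : X} (h : x ⤳ y) (hne : x ≠ y) :
    deltaPt δ f y < deltaPt δ f x := by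
  rw [hf.extendsStrictSpec.deltaPt_eq, hf.extendsStrictSpec.deltaPt_eq]
  exact_mod_cast hf.extendsStrictSpec.2 δ hδ h hne

end BScheme

lemma exists_isGenDimFunction {B : Scheme.{u}} (hB : topologicalKrullDim B < ⊤)
    (c : irreducibleComponents (B : Type u) → ℤ)
    (hc : ∀ k : irreducibleComponents (B : Type u), ∃ n : ℕ,
      topologicalKrullDim ↥(k : Set B) = (n : WithBot ℕ∞) ∧ (n : ℤ) ≤ c k) :
    ∃ δ : B → ℕ,
      (∀ b : B, IsLeast
        {m : ℤ | ∃ k : irreducibleComponents (B : Type u),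
          b ∈ (k : Set B) ∧ m = c k + componentDelta (k : Set B) b} (δ b : ℤ)) ∧
      IsGenDimFunction δ := by
  have hfin : ∀ (b : B) (Y : Set B), codim {b} Y ≠ ⊤ := fun b Y h => by
    have : Nonempty B := ⟨b⟩
    have h1 := codim_le_topologicalKrullDim {b} Y
    rw [h] at h1
    exact hB.not_ge h1
  let S : B → Set ℤ := fun b => {m : ℤ | ∃ k : irreducibleComponents (B : Type u),
    b ∈ (k : Set B) ∧ m = c k + componentDelta (k : Set B) b}
  have hS0 : ∀ b, ∀ m ∈ S b, 0 ≤ m := by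
    rintro b _ ⟨k, hbk, rfl⟩
    obtain ⟨n, hn, hnc⟩ := hc k
    have h1 := codim_le_topologicalKrullDim_subspace {b} (Set.singleton_nonempty b)
      (Set.singleton_subset_iff.2 hbk)
    rw [hn] at h1
    have h2 : codim {b} (k : Set B) ≤ (n : ℕ∞) := by exact_mod_cast h1
    have h3 : (codim {b} (k : Set B)).toNat ≤ n := ENat.toNat_le_of_le_natCast h2
    simp only [componentDelta]
    omega
  have hleast : ∀ b, ∃ m : ℕ, IsLeast (S b) (m : ℤ) := fun b => by
    obtain ⟨m, hm, hmin⟩ := Int.exists_least_of_bdd (P := fun m => m ∈ S b) ⟨0, hS0 b⟩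
      ⟨_, ⟨_, irreducibleComponent_mem_irreducibleComponents b⟩, mem_irreducibleComponent, rfl⟩
    lift m to ℕ using hS0 b m hm
    exact ⟨m, hm, hmin⟩
  choose δ hδ using hleast
  refine ⟨δ, hδ, ?_⟩
  have hstrict : StrictSpec δ := by
    intro b b' hbb' hne
    -- A component realizing the minimum at `b` is closed, so it also contains `b'` and competes in
    -- the minimum there.
    obtain ⟨k, hbk, hk⟩ := (hδ b).1
    have hcl := isClosed_of_mem_irreducibleComponents k.1 k.2
    have h1 := (hδ b').2 ⟨k, hbb'.mem_closed hcl hbk, rfl⟩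
    have h2 := codim_add_one_le hbb' hne hcl hbk
    rw [← ENat.natCast_toNat (hfin b k.1), ← ENat.natCast_toNat (hfin b' k.1)] at h2
    have h3 : (codim {b} k.1).toNat + 1 ≤ (codim {b'} k.1).toNat := by exact_mod_cast h2
    simp only [componentDelta] at hk h1
    omega
  exact fun b b' h => hstrict.add_codim_le (specializes_iff_mem_closure.2 h)

/-! ### Comparison of `δ`-dimensions along morphisms. -/

section

variable {X U B : Scheme.{u}} {δ : B → ℕ} {f : X ⟶ B}

lemma IsEssFiniteType.deltaPt_add_codim_le [IsLocallyNoetherian B] (hδ : StrictSpec δ)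
    (hf : IsEssFiniteType f) {x x' : X} (h : x ⤳ x') :
    deltaPt δ f x' + codim {x'} (closure {x}) ≤ deltaPt δ f x := by
  rw [hf.extendsStrictSpec.deltaPt_eq, hf.extendsStrictSpec.deltaPt_eq]
  exact (hf.extendsStrictSpec.2 δ hδ).add_codim_le h

lemma IsEssFiniteType.topologicalKrullDim_le_deltaDim [IsLocallyNoetherian B] (hδ : StrictSpec δ)
    (hf : IsEssFiniteType f) : topologicalKrullDim X ≤ deltaDim δ f := by
  refine (hf.extendsStrictSpec.2 δ hδ).topologicalKrullDim_le.trans (le_of_eq ?_)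
  exact iSup_congr fun x => by rw [hf.extendsStrictSpec.deltaPt_eq]

lemma IsEssFiniteType.exists_deltaDim_eq_natCast [IsNoetherian B] [Nonempty X] (hδ : StrictSpec δ)
    (hf : IsEssFiniteType f) : ∃ n : ℕ, deltaDim δ f = (n : WithBot ℕ∞) := by
  obtain ⟨η, -, h⟩ := exists_deltaDim_eq hδ hf
  exact ⟨extendDelta δ f η, by rw [h, hf.extendsStrictSpec.deltaPt_eq]; rfl⟩

variable [IsNoetherian B] {v : U ⟶ X}

lemma deltaDim_comp_le (hδ : StrictSpec δ) (hg : IsEssFiniteType (v ≫ f)) {d : ℕ}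
    (hd : IsGenericallyOfDimLE v d) :
    deltaDim δ (v ≫ f) ≤ deltaDim δ f + (d : WithBot ℕ∞) := by
  refine deltaDim_le hδ hg fun η hη => ?_
  rw [deltaPt_comp, WithBot.coe_add]
  exact add_le_add (deltaPt_le_deltaDim _ _ _) (WithBot.coe_le_coe.2 (hd η hη))

lemma deltaDim_comp_eq (hδ : StrictSpec δ) (hf : IsEssFiniteType f)
    (hg : IsEssFiniteType (v ≫ f)) (hd : IsGenericallyOfDimLE v 0) (hv : IsDominant v) :
    deltaDim δ (v ≫ f) = deltaDim δ f := by
  have := hg.noetherianSpace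
  refine le_antisymm (by simpa using deltaDim_comp_le hδ hg hd) ?_
  refine deltaDim_le hδ hf fun ξ hξ => ?_
  obtain ⟨η, -, rfl⟩ := exists_genericPoints_map_eq v.continuous v.denseRange hξ
  refine le_trans ?_ (deltaPt_le_deltaDim _ _ η)
  rw [deltaPt_comp, WithBot.coe_le_coe]
  exact le_self_add

lemma deltaDim_comp_lt [Nonempty X] (hδ : StrictSpec δ) (hf : IsEssFiniteType f)
    (hg : IsEssFiniteType (v ≫ f)) {d : ℕ} (hd : IsGenericallyOfDimLE v d)
    (hv : IsNowhereDense (Set.range v)) :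
    deltaDim δ (v ≫ f) < deltaDim δ f + (d : WithBot ℕ∞) := by
  have := hf.noetherianSpace
  obtain ⟨n, hn⟩ := hf.exists_deltaDim_eq_natCast hδ
  rcases isEmpty_or_nonempty U with hU | hU
  · rw [deltaDim, iSup_of_empty, hn]
    exact WithBot.bot_lt_coe _
  obtain ⟨η, hη, h⟩ := exists_deltaDim_eq hδ hg
  obtain ⟨ξ, hξ, hξη⟩ := exists_genericPoints_specializes (v η)
  -- A nowhere dense image contains no generic point of `X`, so `ξ` specializes properly to `v η`
  -- and the inequality becomes strict.
  have hne : ξ ≠ v η := fun e =>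
    notMem_genericPoints_of_isNowhereDense hv ⟨η, rfl⟩ (e ▸ hξ)
  have h1 := hf.deltaPt_lt_of_specializes hδ hξη hne
  have h2 := deltaPt_le_deltaDim δ f ξ
  rw [h, deltaPt_comp]
  have h3 : deltaPt δ f (v η) + resTrdeg v η < deltaPt δ f ξ + d :=
    (add_le_add_right (hd η hη) _).trans_lt
      (WithTop.add_lt_add_right (ENat.natCast_ne_top d) h1)
  exact (WithBot.coe_lt_coe.2 h3).trans_le
    ((WithBot.coe_add _ _).le.trans (add_le_add_left h2 _))

/-- Residue fields do not change along `v`, so `δ` at a generic point `η` of `U` attaining the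
supremum is `δ` at `v η`; this is compared with the generic point of a suitable component of `X`. -/
lemma deltaDim_comp_add_le [IsPreimmersion v] (hδ : StrictSpec δ) (hf : IsEssFiniteType f)
    (hg : IsEssFiniteType (v ≫ f)) {c : ℕ}
    (hc : ∀ T ∈ irreducibleComponents (U : Type u), ∃ Y ∈ irreducibleComponents (X : Type u),
      v '' T ⊆ Y ∧ (c : ℕ∞) ≤ codim (v '' T) Y) :
    deltaDim δ (v ≫ f) + (c : WithBot ℕ∞) ≤ deltaDim δ f := by
  rcases isEmpty_or_nonempty U with hU | hU
  · rw [deltaDim, iSup_of_empty, WithBot.bot_add]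
    exact bot_le
  obtain ⟨η, hη, h⟩ := exists_deltaDim_eq hδ hg
  obtain ⟨Y, hY, hsub, hcod⟩ := hc _ hη
  let ξ := genericPoints.ofComponent ⟨Y, hY⟩
  have hξ : closure {ξ.1} = Y := genericPoints.isGenericPoint_ofComponent ⟨Y, hY⟩
  have hmem : v η ∈ v '' closure {η} := ⟨η, subset_closure rfl, rfl⟩
  have h1 := hf.deltaPt_add_codim_le hδ (x := ξ.1) (x' := v η)
    (specializes_iff_mem_closure.2 (hξ ▸ hsub hmem))
  rw [hξ] at h1
  have h2 : (c : ℕ∞) ≤ codim {v η} Y :=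
    hcod.trans (codim_mono (Set.singleton_subset_iff.2 hmem))
  rw [h, deltaPt_comp, resTrdeg_eq_zero, add_zero]
  exact (WithBot.coe_le_coe.2 ((add_le_add_right h2 _).trans h1)).trans
    (deltaPt_le_deltaDim _ _ _)

end

lemma isGenericallyOfDimLE_of_fiber {U X : Scheme.{u}} [NoetherianSpace U] (v : U ⟶ X)
    [LocallyOfFiniteType v] {d : ℕ} (V : U.Opens) (hV : Dense (V : Set U))
    (hd : ∀ x : X, topologicalKrullDim ↥((V : Set U) ∩ v ⁻¹' {x}) ≤ (d : WithBot ℕ∞)) :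
    IsGenericallyOfDimLE v d := fun η hη =>
  resTrdeg_le_of_topologicalKrullDim_fiber_le v V η
    (genericPoints_mem_of_dense hη V.isOpen hV) (hd _)

end GenDim

theorem mainTheorem7 (B : Scheme.{u}) [IsNoetherian B] [B.IsSeparated]
    (hB : topologicalKrullDim B < ⊤) :
    -- construction of generalized dimension functions from the irreducible components of `B`
    (∀ c : irreducibleComponents (B : Type u) → ℤ,
      (∀ k : irreducibleComponents (B : Type u), ∃ n : ℕ, topologicalKrullDim ↥(k : Set B) = (n : WithBot ℕ∞) ∧ (n : ℤ) ≤ c k) →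
      ∃ δ : B → ℕ,
        (∀ b : B, IsLeast
          {m : ℤ | ∃ k : irreducibleComponents (B : Type u),
            b ∈ (k : Set B) ∧ m = c k + GenDim.componentDelta (k : Set B) b} (δ b : ℤ)) ∧
        GenDim.IsGenDimFunction δ) ∧
    -- properties of an arbitrary generalized dimension function
    ∀ δ : B → ℕ, GenDim.IsGenDimFunction δ →
      ∀ (X : Scheme.{u}) (f : X ⟶ B), GenDim.IsBScheme f →
        -- specializations
        (∀ x x' : X, x' ∈ closure {x} →
          GenDim.deltaPt δ f x' + GenDim.codim {x'} (closure {x}) ≤ GenDim.deltaPt δ f x) ∧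
        -- generic points, finiteness, comparison with the Krull dimension
        (Nonempty X →
          IsGreatest ((fun x : X => (GenDim.deltaPt δ f x : WithBot ℕ∞)) '' genericPoints X)
            (GenDim.deltaDim δ f) ∧
          ∃ n : ℕ, GenDim.deltaDim δ f = (n : WithBot ℕ∞)) ∧
        topologicalKrullDim X ≤ GenDim.deltaDim δ f ∧
        ∀ (U : Scheme.{u}) (g : U ⟶ B), GenDim.IsBScheme g →
          ∀ v : U ⟶ X, v ≫ f = g →
            -- morphisms generically of dimension at most `d`
            (∀ d : ℕ, GenDim.IsGenericallyOfDimLE v d →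
              GenDim.deltaDim δ g ≤ GenDim.deltaDim δ f + (d : WithBot ℕ∞) ∧
              (d = 0 → IsDominant v → GenDim.deltaDim δ g = GenDim.deltaDim δ f) ∧
              (Nonempty X → IsNowhereDense (Set.range v) →
                GenDim.deltaDim δ g < GenDim.deltaDim δ f + (d : WithBot ℕ∞))) ∧
            -- in the finite type case, fibres of dimension at most `d` over a dense open subscheme
            -- suffice for being generically of dimension at most `d`
            (∀ d : ℕ, LocallyOfFiniteType v →
              (∃ V : U.Opens, Dense (V : Set U) ∧
                ∀ x : X, topologicalKrullDim ↥((V : Set U) ∩ v ⁻¹' {x}) ≤ (d : WithBot ℕ∞)) →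
              GenDim.IsGenericallyOfDimLE v d) ∧
            -- subschemes of codimension at least `c`
            (∀ c : ℕ, IsPreimmersion v →
              (∀ T ∈ irreducibleComponents (U : Type u),
                ∃ Y ∈ irreducibleComponents (X : Type u),
                  v '' T ⊆ Y ∧ (c : ℕ∞) ≤ GenDim.codim (v '' T) Y) →
              GenDim.deltaDim δ g + (c : WithBot ℕ∞) ≤ GenDim.deltaDim δ f) := by
  refine ⟨fun c hc => GenDim.exists_isGenDimFunction hB c hc, fun δ hδ' X f hfB => ?_⟩
  have hδ : GenDim.StrictSpec δ := GenDim.strictSpec_of_codim_le hδ'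
  have hf := hfB.2
  refine ⟨fun x x' h => hf.deltaPt_add_codim_le hδ (specializes_iff_mem_closure.2 h),
    fun _ => ⟨⟨?_, ?_⟩, hf.exists_deltaDim_eq_natCast hδ⟩,
    hf.topologicalKrullDim_le_deltaDim hδ, ?_⟩
  · obtain ⟨η, hη, h⟩ := GenDim.exists_deltaDim_eq hδ hf
    exact ⟨η, hη, h.symm⟩
  · rintro _ ⟨η, -, rfl⟩
    exact GenDim.deltaPt_le_deltaDim δ f η
  · rintro U _ hgB v rfl
    have hg := hgB.2
    have := hg.noetherianSpace
    refine ⟨fun d hd => ⟨GenDim.deltaDim_comp_le hδ hg hd, ?_, ?_⟩, ?_, ?_⟩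
    · rintro rfl hv
      exact GenDim.deltaDim_comp_eq hδ hf hg hd hv
    · intro _ hv
      exact GenDim.deltaDim_comp_lt hδ hf hg hd hv
    · rintro d _ ⟨V, hV, hd⟩
      exact GenDim.isGenericallyOfDimLE_of_fiber v V hV hd
    · intro c _ hc
      exact GenDim.deltaDim_comp_add_le hδ hf hg hc
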